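/- Let $S$ (suppliers) and $D$ (demanders) be finite sets, let $E\subseteq S\times D$ be a set of edges, and let each edge $(i,j)\in E$ have a capacity $u_{ij}\in[0,\infty]$. A flow $\varphi=(\varphi_{ij})_{i\in S,\,j\in D}$, $\varphi_{ij}\ge 0$, is carried by the network if $\varphi_{ij}\le u_{ij}$ for $(i,j)\in E$ and $\varphi_{ij}=0$ for $(i,j)\notin E$; the net transfer $z_k(\varphi)$ of agent $k\in S\cup D$ is $\sum_{j\in D}\varphi_{kj}$ if $k\in S$ and $\sum_{i\in S}\varphi_{ik}$ if $k\in D$. Each agent $k$ has a single-peaked preference $R_k$ over its net transfer: a complete transitive relation on $[0,\infty)$, with strict part $P_k$ and a peak $p[R_k]\ge 0$, such that $a<b\le p[R_k]$ implies $b\,P_k\,a$ and $p[R_k]\le a<b$ implies $a\,P_k\,b$. A mechanism $M$ maps each profile $R=(R_k)_{k\in S\cup D}$ of single-peaked preferences to a flow $M(R)$; write $z_k(R)$ for $z_k(M(R))$. It is peak-only if $M(R)$ depends on $R$ only through the peaks $p[R_k]$. A flow $\varphi$ is in $PO^*$ for the profile $R$ if it is carried by the network, its net transfers are Pareto optimal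 (if a flow $\psi$ carried by the network satisfies $z_k(\psi)\,R_k\,z_k(\varphi)$ for all $k$, then also $z_k(\varphi)\,R_k\,z_k(\psi)$ for all $k$), and $z_k(\varphi)\le p[R_k]$ for every agent $k$. Strong invariance: for every agent $k\in S\cup D$, every profile $R$ and every profile $R'$ that differs from $R$ at most in the report of $k$, if either $p[R_k]<z_k(R)$ and $p[R'_k]\le z_k(R)$, or $p[R_k]>z_k(R)$ and $p[R'_k]\ge z_k(R)$, then $z_l(R')=z_l(R)$ for all $l\in S\cup D$. Group strategyproofness: there are no profile $R$ (the true preferences), coalition $A\subseteq S\cup D$ and profile $R'$ with $R'_k=R_k$ for all $k\notin A$ such that $z_k(R')\,R_k\,z_k(R)$ for all $k\in A$ and $z_k(R')\,P_k\,z_k(R)$ for some $k\in A$. Theorem. Let $M$ be a peak-only mechanism on the network such that $M(R)$ is in $PO^*$ for $R$, for every profile $R$. Then $M$ satisfies strong invariance if and only if it is group strategyproof. -/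

import Mathlib

open scoped NNReal ENNReal

namespace BipartiteFlow

/-- A capacitated bipartite network with supply nodes `S` and demand nodes `D`: the set of edges
and the (non-negative, possibly infinite) capacity of each edge. -/
structure Network (S D : Type*) where
  Adj : S → D → Prop
  cap : S → D → ℝ≥0∞

/-- A flow: the amount sent by each supplier to each demander. -/
abbrev Flow (S D : Type*) := S → D → ℝ≥0

/-- The flow can be realised in the network: nothing is sent along a non-edge, and no edge carries
more than its capacity. -/
def Network.Carries {S D : Type*} (N : Network S D) (φ : Flow S D) : Prop :=
  (∀ i j, N.Adj i j → (φ i j : ℝ≥0∞) ≤ N.cap i j) ∧ (∀ i j, ¬ N.Adj i j → φ i j = 0)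

/-- The net transfer of each agent under a flow: `∑ j, φ i j` for a supplier `i` and `∑ i, φ i j`
for a demander `j`. (A flow carried by a network vanishes off the edges, so these are the sums
over the neighbours of the agent.) -/
def netTransfer {S D : Type*} [Fintype S] [Fintype D] (φ : Flow S D) : S ⊕ D → ℝ≥0 :=
  Sum.elim (fun i => ∑ j, φ i j) (fun j => ∑ i, φ i j)

/-- A single-peaked preference over `[0, ∞)`: a complete and transitive relation, where `pref a b`
means that `a` is weakly preferred to `b`, which is strictly increasing up to the peak and strictly
decreasing beyond it. -/
structure SinglePeaked where
  pref : ℝ≥0 → ℝ≥0 → Prop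
  total : ∀ a b, pref a b ∨ pref b a
  trans : ∀ a b c, pref a b → pref b c → pref a c
  peak : ℝ≥0
  below_peak : ∀ a b, a < b → b ≤ peak → pref b a ∧ ¬ pref a b
  above_peak : ∀ a b, peak ≤ a → a < b → pref a b ∧ ¬ pref b a

/-- `a` is strictly preferred to `b`. -/
def SinglePeaked.strict (P : SinglePeaked) (a b : ℝ≥0) : Prop :=
  P.pref a b ∧ ¬ P.pref b a

/-- A preference profile: a single-peaked preference for each supplier and each demander. -/
abbrev Profile (S D : Type*) := S ⊕ D → SinglePeaked

/-- A mechanism on a given network: it maps each reported preference profile to a flow. -/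
abbrev Mechanism (S D : Type*) := Profile S D → Flow S D

/-- The flow depends on the reported profile only through the reported peaks. -/
def PeakOnly {S D : Type*} (M : Mechanism S D) : Prop :=
  ∀ R R' : Profile S D, (∀ k, (R k).peak = (R' k).peak) → M R = M R'

section

variable {S D : Type*} [Fintype S] [Fintype D]

/-- The net transfers induced by `φ` are Pareto optimal for the profile `R`: whenever the net
transfers of a flow carried by the network are weakly preferred by every agent, every agent is
indifferent. -/
def ParetoOptimal (N : Network S D) (R : Profile S D) (φ : Flow S D) : Prop :=
  N.Carries φ ∧ ∀ ψ : Flow S D, N.Carries ψ →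
    (∀ k, (R k).pref (netTransfer ψ k) (netTransfer φ k)) →
    ∀ k, (R k).pref (netTransfer φ k) (netTransfer ψ k)

/-- The set `PO*`: Pareto optimal, and no agent gets more than its peak. -/
def InPOStar (N : Network S D) (R : Profile S D) (φ : Flow S D) : Prop :=
  ParetoOptimal N R φ ∧ ∀ k, netTransfer φ k ≤ (R k).peak

/-- Strong invariance. If an agent `k`, supplier or demander, changes its report so that its old and
new peaks lie on the same side of its allocation (the old one strictly), then the allocation of
every agent is unchanged. -/
def StronglyInvariant (M : Mechanism S D) : Prop :=
  ∀ (k : S ⊕ D) (R R' : Profile S D), (∀ l, l ≠ k → R' l = R l) →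
    (((R k).peak < netTransfer (M R) k ∧ (R' k).peak ≤ netTransfer (M R) k) ∨
      ((R k).peak > netTransfer (M R) k ∧ (R' k).peak ≥ netTransfer (M R) k)) →
    ∀ l, netTransfer (M R') l = netTransfer (M R) l

/-- Group strategyproofness. For true preferences `R`, no coalition `A` has a joint misreport (the
agents outside `A` reporting as before) that makes every member of `A` weakly better off and some
member of `A` strictly better off. -/
def GroupStrategyproof (M : Mechanism S D) : Prop :=
  ∀ (A : Set (S ⊕ D)) (R R' : Profile S D), (∀ k, k ∉ A → R' k = R k) →
    ¬ ((∀ k ∈ A, (R k).pref (netTransfer (M R') k) (netTransfer (M R) k)) ∧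
      ∃ k ∈ A, (R k).strict (netTransfer (M R') k) (netTransfer (M R) k))

end

end BipartiteFlow

/-!
Since `netTransfer (M R) k ≤ (R k).peak` always holds, only the upward half of strong invariance has
content: an agent strictly below its peak can move its report to any value not below its allocation
without affecting anyone. The theorem is a consequence of this, of peak-onlyness, and of the bound
by the peaks.

From strong invariance to group strategyproofness: let a coalition `A` move from `R` to `R'` with
every member weakly better off. A member at its peak under `R` must get its peak under `R'` too, so
at `R'` it can return to the truthful peak without changing any transfer. A member below its peak
under `R` gets no less under `R'`, hence reports a peak not below its original allocation, and at
`R` it can switch to that report without changing any transfer. By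
`StronglyInvariant.netTransfer_eq` either change can be made by many agents at once, and the two
resulting profiles have the same peaks. So all transfers under `R` and `R'` agree and nobody gains.

Conversely, let `k` move its report from a peak strictly above its allocation to another value not
below it. Its own allocation cannot change, by strategyproofness for `k`; the case where it would
overshoot the old peak is excluded by replacing the preference of `k` by one with the same peak that
prefers everything from the peak on to everything below it (`SinglePeaked.favorAbove`). If another
agent's transfer changed, that agent and the indifferent `k` would gain jointly by moving from one
of the two profiles to the other.
-/

namespace BipartiteFlow

namespace SinglePeaked

/-- The single-peaked preference with peak `p` in which every amount `≥ p` is strictly preferred to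
every amount `< p`. -/
def favorAbove (p : ℝ≥0) : SinglePeaked where
  pref a b := (p ≤ a ∧ (b < p ∨ a ≤ b)) ∨ (a < p ∧ b ≤ a)
  total a b := by grind
  trans a b c := by grind
  peak := p
  below_peak a b := by grind
  above_peak a b := by grind

theorem favorAbove_strict {p a b : ℝ≥0} (ha : a < p) (hb : p ≤ b) :
    (favorAbove p).strict b a := by
  simp only [strict, favorAbove]
  grind

theorem strict_of_lt_of_le_peak (P : SinglePeaked) {a b : ℝ≥0} (hab : a < b) (hb : b ≤ P.peak) :
    P.strict b a :=
  P.below_peak a b hab hb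

theorem pref_refl (P : SinglePeaked) (a : ℝ≥0) : P.pref a a :=
  (P.total a a).elim id id

theorem le_of_pref (P : SinglePeaked) {a b : ℝ≥0} (h : P.pref b a) (ha : a ≤ P.peak) : a ≤ b := by
  by_contra! hlt
  exact (P.below_peak b a hlt ha).2 h

theorem eq_peak_of_pref (P : SinglePeaked) {b : ℝ≥0} (h : P.pref b P.peak) : b = P.peak := by
  refine le_antisymm ?_ (P.le_of_pref h le_rfl)
  by_contra! hlt
  exact (P.above_peak P.peak b le_rfl hlt).2 h

end SinglePeaked

variable {S D : Type*} [Fintype S] [Fintype D] {M : Mechanism S D}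

/-- Strong invariance for simultaneous changes of report: the agents in `T` are strictly below their
peaks and move them to other values at least their allocations. The changes can be made one by one,
as each of them leaves all allocations, and so the hypothesis for the remaining agents, unchanged. -/
theorem StronglyInvariant.netTransfer_eq (hM : StronglyInvariant M) {R : Profile S D}
    (T : Finset (S ⊕ D)) (R' : Profile S D) (hout : ∀ k, k ∉ T → R' k = R k)
    (hlt : ∀ k ∈ T, netTransfer (M R) k < (R k).peak)
    (hle : ∀ k ∈ T, netTransfer (M R) k ≤ (R' k).peak) :
    netTransfer (M R') = netTransfer (M R) := by
  classical
  induction T using Finset.induction_on generalizing R' with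
  | empty => rw [funext fun k => hout k (Finset.notMem_empty k)]
  | insert k T hk ih =>
    have h₁ : netTransfer (M (Function.update R' k (R k))) = netTransfer (M R) := by
      apply ih
      · intro l hl
        rcases eq_or_ne l k with rfl | hlk
        · simp
        · simpa [hlk] using hout l (by simp [hlk, hl])
      · exact fun l hl => hlt l (Finset.mem_insert_of_mem hl)
      · intro l hl
        have hlk : l ≠ k := fun h => hk (h ▸ hl)
        simpa [hlk] using hle l (Finset.mem_insert_of_mem hl)
    rw [← h₁]
    funext l
    refine hM k _ R' (fun l hl => by simp [hl]) (Or.inr ?_) l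
    rw [h₁]
    simpa using ⟨hlt k (Finset.mem_insert_self k T), hle k (Finset.mem_insert_self k T)⟩

theorem StronglyInvariant.groupStrategyproof (hM : StronglyInvariant M) (hpeak : PeakOnly M)
    (hle : ∀ R k, netTransfer (M R) k ≤ (R k).peak) : GroupStrategyproof M := by
  classical
  rintro A R R' hout ⟨hweak, k₀, hk₀, hstrict⟩
  have hat : ∀ k ∈ A, netTransfer (M R) k = (R k).peak → netTransfer (M R') k = (R k).peak :=
    fun k hk h => (R k).eq_peak_of_pref (h ▸ hweak k hk)
  -- Members of `A` at their peaks under `R` return to the truthful report at `R'`; those whose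
  -- reported peak is already the true one are left alone, as strong invariance says nothing there.
  let T := {k : S ⊕ D | k ∈ A ∧ netTransfer (M R) k = (R k).peak ∧ (R' k).peak ≠ (R k).peak}.toFinset
  let Q : Profile S D := fun k => if k ∈ T then R k else R' k
  have hQ : netTransfer (M Q) = netTransfer (M R') := by
    refine hM.netTransfer_eq T Q (fun k hk => by simp [Q, hk]) ?_ ?_
    · intro k hk
      obtain ⟨hA, heq, hne⟩ : k ∈ A ∧ netTransfer (M R) k = (R k).peak ∧
        (R' k).peak ≠ (R k).peak := by simpa [T] using hk
      exact lt_of_le_of_ne (hle R' k) (hat k hA heq ▸ hne.symm)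
    · intro k hk
      obtain ⟨hA, heq, -⟩ : k ∈ A ∧ netTransfer (M R) k = (R k).peak ∧
        (R' k).peak ≠ (R k).peak := by simpa [T] using hk
      simp [Q, hk, hat k hA heq]
  -- Members of `A` below their peaks under `R` switch to their reports in `R'`.
  let T' := {k : S ⊕ D | k ∈ A ∧ netTransfer (M R) k < (R k).peak}.toFinset
  let Q' : Profile S D := fun k => if k ∈ T' then R' k else R k
  have hQ' : netTransfer (M Q') = netTransfer (M R) := by
    refine hM.netTransfer_eq T' Q' (fun k hk => by simp [Q', hk]) ?_ ?_
    · intro k hk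
      have : k ∈ A ∧ netTransfer (M R) k < (R k).peak := by simpa [T'] using hk
      exact this.2
    · intro k hk
      have hA : k ∈ A ∧ netTransfer (M R) k < (R k).peak := by simpa [T'] using hk
      simpa [Q', hk] using ((R k).le_of_pref (hweak k hA.1) (hle R k)).trans (hle R' k)
  have hQQ' : M Q = M Q' := by
    refine hpeak Q Q' fun k => ?_
    by_cases hA : k ∈ A
    · rcases (hle R k).eq_or_lt with heq | hlt
      · by_cases hne : (R' k).peak = (R k).peak <;> simp [Q, Q', T, T', hA, heq, hne]
      · simp [Q, Q', T, T', hA, hlt, hlt.ne]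
    · simp [Q, Q', T, T', hA, hout k hA]
  have hRR' : netTransfer (M R') = netTransfer (M R) := by rw [← hQ, hQQ', hQ']
  rw [hRR'] at hstrict
  exact hstrict.2 hstrict.1

/-- Strategyproofness for `k` alone: the allocation of `k` does not change if its peak moves from
strictly above its allocation to another value at least its allocation. -/
theorem GroupStrategyproof.netTransfer_self_eq (hM : GroupStrategyproof M) (hpeak : PeakOnly M)
    {k : S ⊕ D} {R R' : Profile S D} (hout : ∀ l, l ≠ k → R' l = R l)
    (hlt : netTransfer (M R) k < (R k).peak)
    (hle' : netTransfer (M R) k ≤ (R' k).peak) :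
    netTransfer (M R') k = netTransfer (M R) k := by
  classical
  have sp : ∀ Q Q' : Profile S D, (∀ l, l ≠ k → Q' l = Q l) →
      ¬ (Q k).strict (netTransfer (M Q') k) (netTransfer (M Q) k) := fun Q Q' h hs =>
    hM {k} Q Q' (fun l hl => h l hl) ⟨by simpa using hs.1, k, rfl, hs⟩
  apply le_antisymm
  · by_contra! hgain
    rcases le_total (netTransfer (M R') k) (R k).peak with h | h
    · exact sp R R' hout ((R k).strict_of_lt_of_le_peak hgain h)
    · -- The true preference of `k` may dislike overshooting its peak, but the mechanism cannot
      -- distinguish it from `favorAbove`, for which the overshoot is a gain.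
      have hQ : M (Function.update R k (.favorAbove (R k).peak)) = M R := by
        refine hpeak _ _ fun l => ?_
        rcases eq_or_ne l k with rfl | hl
        · simp [SinglePeaked.favorAbove]
        · simp [hl]
      refine sp (Function.update R k (.favorAbove (R k).peak)) R'
        (fun l hl => by simpa [hl] using hout l hl) ?_
      rw [hQ]
      simpa using SinglePeaked.favorAbove_strict hlt h
  · by_contra! hloss
    exact sp R' R (fun l hl => (hout l hl).symm) ((R' k).strict_of_lt_of_le_peak hloss hle')

/-- A change of report by an agent that leaves its own allocation unchanged cannot raise anyone
else's: that agent would gain in coalition with the indifferent one. -/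
theorem GroupStrategyproof.netTransfer_le (hM : GroupStrategyproof M)
    (hle : ∀ R k, netTransfer (M R) k ≤ (R k).peak) {k : S ⊕ D} {R R' : Profile S D}
    (hout : ∀ l, l ≠ k → R' l = R l) (hk : netTransfer (M R') k = netTransfer (M R) k)
    (l : S ⊕ D) : netTransfer (M R') l ≤ netTransfer (M R) l := by
  by_contra! hgain
  have hlk : l ≠ k := by
    rintro rfl
    exact hgain.ne' hk
  have hs : (R l).strict (netTransfer (M R') l) (netTransfer (M R) l) :=
    (R l).strict_of_lt_of_le_peak hgain (hout l hlk ▸ hle R' l)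
  refine hM {k, l} R R' (fun m hm => hout m fun h => hm (Or.inl h)) ⟨?_, l, Or.inr rfl, hs⟩
  rintro m (rfl | rfl)
  · rw [hk]
    exact (R m).pref_refl _
  · exact hs.1

theorem GroupStrategyproof.stronglyInvariant (hM : GroupStrategyproof M) (hpeak : PeakOnly M)
    (hle : ∀ R k, netTransfer (M R) k ≤ (R k).peak) : StronglyInvariant M := by
  rintro k R R' hout (⟨hlt, -⟩ | ⟨hlt, hle'⟩) l
  · exact absurd hlt (hle R k).not_gt
  · have hk := hM.netTransfer_self_eq hpeak hout hlt hle'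
    exact le_antisymm (hM.netTransfer_le hle hout hk l)
      (hM.netTransfer_le hle (fun m hm => (hout m hm).symm) hk.symm l)

end BipartiteFlow

theorem mainTheorem1 {S D : Type*} [Fintype S] [Fintype D]
    (N : BipartiteFlow.Network S D) (M : BipartiteFlow.Mechanism S D)
    (hpeak : BipartiteFlow.PeakOnly M)
    (hPO : ∀ R : BipartiteFlow.Profile S D, BipartiteFlow.InPOStar N R (M R)) :
    BipartiteFlow.StronglyInvariant M ↔ BipartiteFlow.GroupStrategyproof M :=
  ⟨fun h => h.groupStrategyproof hpeak fun R => (hPO R).2,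
    fun h => h.stronglyInvariant hpeak fun R => (hPO R).2⟩
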